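/- Let $K$ be a field, let $G$ be a finite simple graph on the vertex set $[n]=\{1,\dots,n\}$ with edge set $E(G)$, let $R=K[x_1,\dots,x_n]$ and $\mathfrak m=(x_1,\dots,x_n)$, and let $I(G)=(x_ix_j \mid \{i,j\}\in E(G))\subseteq R$ be the edge ideal of $G$. For an ideal $I=(f_1,\dots,f_m)$ of $R$, let $T=R[y_1,\dots,y_m]$, let $J$ be the kernel of the $R$-algebra homomorphism $T\to R[t]$, $y_j\mapsto f_jt$ (whose image is the Rees algebra of $I$), and let $L\subseteq J$ be the ideal of $T$ generated by the linear forms $\sum_j a_jy_j$ with $a_j\in R$ and $\sum_j a_jf_j=0$. The conductor of $I$ is the ideal $C(I)=L:_RJ=\{r\in R\mid rJ\subseteq L\}$ of $R$; it does not depend on the choice of the generators $f_j$. An even closed walk of $G$ of length $2q>0$ is a sequence of edges $\Gamma=(e_1,\dots,e_{2q})$ of the form $e_k=\{j_k,j_{k+1}\}$ for $1\le k\le 2q$, where $j_{2q+1}=j_1$ (vertices and edges may be repeated); its vertices are $j_1,\dots,j_{2q}$. With one variable $y_e$ for each edge $e$ of $G$, put $h_\Gamma=\prod_{k=1}^q y_{e_{2k-1}}-\prod_{k=1}^q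 y_{e_{2k}}$. The walk $\Gamma$ is non-trivial if $h_\Gamma\neq 0$. A vertex $i$ of $G$ is adjacent to $\Gamma$ if $i$ is adjacent in $G$ to some vertex of $\Gamma$ (in particular every vertex of $\Gamma$ is adjacent to $\Gamma$). Then the following are equivalent: 1. $C(I(G))$ is $\mathfrak m$-primary. 2. $C(I(G))=\mathfrak m$. 3. $G$ has a non-trivial even closed walk, and every vertex of $G$ is adjacent to every non-trivial even closed walk of $G$. -/

import Mathlib

noncomputable section

namespace ConductorIdeal

section Conductor

variable {R : Type*} [CommRing R] {ι : Type*}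

/-- For a family `f` of elements of `R`, the `R`-algebra homomorphism
`φ : T = R[y_j | j ∈ ι] → R[t]`, `y_j ↦ f_j t`. Its image is the Rees algebra of the ideal
generated by the `f_j`. -/
def reesMap (f : ι → R) : MvPolynomial ι R →ₐ[R] Polynomial R :=
  MvPolynomial.aeval fun j => Polynomial.C (f j) * Polynomial.X

/-- The defining ideal `J = Ker φ` of the Rees algebra, as an ideal of `T`. -/
def reesIdeal (f : ι → R) : Ideal (MvPolynomial ι R) :=
  RingHom.ker (reesMap f)

/-- The linear form `∑ a_j y_j` of `T`. -/
def linearForm (a : ι →₀ R) : MvPolynomial ι R :=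
  a.sum fun j c => MvPolynomial.C c * MvPolynomial.X j

/-- The ideal `L ⊆ J` of `T` generated by the linear relations, that is, by the linear forms
`∑ a_j y_j` with `∑ a_j f_j = 0`. -/
def linearIdeal (f : ι → R) : Ideal (MvPolynomial ι R) :=
  Ideal.span {p | ∃ a : ι →₀ R, (a.sum fun j c => c * f j) = 0 ∧ p = linearForm a}

/-- `L :_R J = {r ∈ R | r J ⊆ L}`, for the presentation given by the generating family `f`. -/
def conductorOfGenerators (f : ι → R) : Ideal R :=
  Ideal.comap MvPolynomial.C
    ((linearIdeal f).colon (reesIdeal f : Set (MvPolynomial ι R)))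

/-- The conductor `C(I) = L :_R J` of an ideal `I`. The ideal `L :_R J` is the same for all
generating families of `I` (see `conductorOfGenerators_eq_conductor`); the definition takes the
family of all elements of `I`. -/
def conductor (I : Ideal R) : Ideal R :=
  conductorOfGenerators (fun a : I => (a : R))

theorem mem_conductorOfGenerators {f : ι → R} {r : R} :
    r ∈ conductorOfGenerators f ↔
      ∀ p ∈ reesIdeal f, MvPolynomial.C r * p ∈ linearIdeal f := by
  simp [conductorOfGenerators, Submodule.mem_colon]

theorem reesMap_linearForm (f : ι → R) (a : ι →₀ R) :
    reesMap f (linearForm a) =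
      Polynomial.C (a.sum fun j c => c * f j) * Polynomial.X := by
  simp only [linearForm, reesMap, Finsupp.sum, map_sum, map_mul, MvPolynomial.aeval_X,
    MvPolynomial.algHom_C, Finset.sum_mul]
  refine Finset.sum_congr rfl fun j _ => ?_
  rw [Polynomial.algebraMap_eq, mul_assoc]

theorem linearForm_mem {f : ι → R} {a : ι →₀ R} (h : reesMap f (linearForm a) = 0) :
    linearForm a ∈ linearIdeal f := by
  refine Ideal.subset_span ⟨a, ?_, rfl⟩
  rw [reesMap_linearForm] at h
  simpa using congrArg (fun p => Polynomial.coeff p 1) h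

theorem linearForm_eq (a : ι →₀ R) :
    linearForm a = Finsupp.linearCombination R (MvPolynomial.X : ι → MvPolynomial ι R) a := by
  simp [linearForm, Finsupp.linearCombination_apply, MvPolynomial.smul_eq_C_mul]

theorem exists_lift {κ : Type*} {f : ι → R} {g : κ → R}
    (h : Ideal.span (Set.range g) ≤ Ideal.span (Set.range f)) :
    ∃ s : κ → ι →₀ R, ∀ k, reesMap f (linearForm (s k)) = reesMap g (MvPolynomial.X k) := by
  have : ∀ k, ∃ a : ι →₀ R, (a.sum fun j c => c * f j) = g k := fun k => by
    have hk : g k ∈ Ideal.span (Set.range f) := h (Ideal.subset_span ⟨k, rfl⟩)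
    obtain ⟨a, ha⟩ := (Finsupp.mem_ideal_span_range_iff_exists_finsupp).1 hk
    exact ⟨a, ha⟩
  choose s hs using this
  refine ⟨s, fun k => ?_⟩
  rw [reesMap_linearForm, hs]
  simp [reesMap]

theorem conductorOfGenerators_le {κ : Type*} {f : ι → R} {g : κ → R}
    (h : Ideal.span (Set.range f) = Ideal.span (Set.range g)) :
    conductorOfGenerators f ≤ conductorOfGenerators g := by
  obtain ⟨s, hs⟩ := exists_lift (f := f) (g := g) h.ge
  obtain ⟨u, hu⟩ := exists_lift (f := g) (g := f) h.le
  let θ : MvPolynomial κ R →ₐ[R] MvPolynomial ι R := MvPolynomial.aeval fun k => linearForm (s k)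
  let ψ : MvPolynomial ι R →ₐ[R] MvPolynomial κ R := MvPolynomial.aeval fun j => linearForm (u j)
  have hθ : ∀ p, reesMap f (θ p) = reesMap g p := fun p => by
    have : (reesMap f).comp θ = reesMap g := MvPolynomial.algHom_ext fun k => by simp [θ, hs]
    exact DFunLike.congr_fun this p
  have hψ : ∀ p, reesMap g (ψ p) = reesMap f p := fun p => by
    have : (reesMap g).comp ψ = reesMap f := MvPolynomial.algHom_ext fun k => by simp [ψ, hu]
    exact DFunLike.congr_fun this p
  have hψlin : ∀ a : ι →₀ R, ∃ b : κ →₀ R, ψ (linearForm a) = linearForm b := fun a => by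
    refine ⟨Finsupp.linearCombination R u a, ?_⟩
    rw [linearForm_eq, linearForm_eq, Finsupp.linearCombination_apply,
      Finsupp.linearCombination_apply R a, Finsupp.sum, Finsupp.sum, map_sum, map_sum]
    refine Finset.sum_congr rfl fun j _ => ?_
    rw [map_smul, map_smul, ← linearForm_eq]
    simp [ψ]
  have hψL : ∀ p ∈ linearIdeal f, ψ p ∈ linearIdeal g := by
    intro p hp
    have : linearIdeal f ≤ (linearIdeal g).comap ψ := by
      refine Ideal.span_le.2 ?_
      rintro _ ⟨a, ha, rfl⟩
      obtain ⟨b, hb⟩ := hψlin a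
      change ψ (linearForm a) ∈ linearIdeal g
      rw [hb]
      refine linearForm_mem ?_
      rw [← hb, hψ, reesMap_linearForm, ha]
      simp
    exact this hp
  have hX : ∀ k : κ, linearForm (Finsupp.single k (1 : R)) = MvPolynomial.X k := fun k => by
    simp [linearForm]
  have hid : ∀ p, ψ (θ p) - p ∈ linearIdeal g := by
    intro p
    have : (Ideal.Quotient.mkₐ R (linearIdeal g)).comp (ψ.comp θ) =
        Ideal.Quotient.mkₐ R (linearIdeal g) := MvPolynomial.algHom_ext fun k => by
      obtain ⟨b, hb⟩ := hψlin (s k)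
      refine Ideal.Quotient.eq.2 ?_
      have h1 : (ψ.comp θ) (MvPolynomial.X k) - MvPolynomial.X k
          = linearForm (b - Finsupp.single k 1) := by
        rw [linearForm_eq, map_sub, ← linearForm_eq, ← linearForm_eq, hX, ← hb]
        simp [θ]
      change (ψ.comp θ) (MvPolynomial.X k) - MvPolynomial.X k ∈ _
      rw [h1]
      refine linearForm_mem ?_
      rw [← h1, map_sub, AlgHom.comp_apply, hψ, hθ, sub_self]
    exact Ideal.Quotient.eq.1 (DFunLike.congr_fun this p)
  intro r hr
  rw [mem_conductorOfGenerators] at hr ⊢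
  intro p hp
  have h1 : θ p ∈ reesIdeal f := by
    change reesMap f (θ p) = 0
    rw [hθ]
    exact hp
  have h2 := hψL _ (hr _ h1)
  rw [map_mul, MvPolynomial.algHom_C] at h2
  have h3 := Ideal.mul_mem_left _ (MvPolynomial.C r) (hid p)
  have h4 := sub_mem h2 h3
  rw [MvPolynomial.algebraMap_eq] at h4
  convert h4 using 1
  ring

/-- The ideal `L :_R J` does not depend on the chosen generators of `I`. -/
theorem conductorOfGenerators_eq_conductor (f : ι → R) :
    conductorOfGenerators f = conductor (Ideal.span (Set.range f)) := by
  have h : Ideal.span (Set.range f) =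
      Ideal.span (Set.range fun a : Ideal.span (Set.range f) => (a : R)) := by
    rw [Subtype.range_coe_subtype]
    exact (Ideal.span_eq _).symm
  exact le_antisymm (conductorOfGenerators_le h) (conductorOfGenerators_le h.symm)

end Conductor

section Graph

variable {V : Type*}

/-- The edge ideal `I(G) = (x_i x_j | {i, j} ∈ E(G))`. -/
def edgeIdeal (K : Type*) [Field K] (G : SimpleGraph V) : Ideal (MvPolynomial V K) :=
  Ideal.span {p | ∃ i j, G.Adj i j ∧ p = MvPolynomial.X i * MvPolynomial.X j}

/-- The ideal `I` is `𝔪`-primary. -/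
def IsPrimaryTo {R : Type*} [CommRing R] (I m : Ideal R) : Prop :=
  I.IsPrimary ∧ I.radical = m

/-- An even closed walk of `G` of length `2q > 0`. Vertices and edges may be repeated. -/
structure EvenClosedWalk (G : SimpleGraph V) where
  base : V
  walk : G.Walk base base
  length_pos : 0 < walk.length
  even_length : Even walk.length

namespace EvenClosedWalk

variable {G : SimpleGraph V}

/-- The `k`-th edge (counted from `0`) of the walk. -/
def edge (Γ : EvenClosedWalk G) (k : ℕ) (hk : k < Γ.walk.length) : G.edgeSet :=
  ⟨s(Γ.walk.getVert k, Γ.walk.getVert (k + 1)), Γ.walk.adj_getVert_succ hk⟩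

/-- The binomial `h_Γ = y_{e₁} y_{e₃} ⋯ y_{e_{2q-1}} - y_{e₂} y_{e₄} ⋯ y_{e_{2q}}` of an even
closed walk `Γ = (e₁, …, e_{2q})`, in the polynomial ring over `R` with one variable `y_e` for each
edge `e` of `G`. -/
def binomial (R : Type*) [CommRing R] (Γ : EvenClosedWalk G) : MvPolynomial G.edgeSet R :=
  (∏ k : Fin (Γ.walk.length / 2), MvPolynomial.X (Γ.edge (2 * k) (by omega))) -
    ∏ k : Fin (Γ.walk.length / 2), MvPolynomial.X (Γ.edge (2 * k + 1) (by omega))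

/-- `Γ` is non-trivial when `h_Γ ≠ 0`. -/
def IsNontrivial (R : Type*) [CommRing R] (Γ : EvenClosedWalk G) : Prop :=
  Γ.binomial R ≠ 0

/-- The vertex `i` is adjacent to some vertex of `Γ`. -/
def IsAdjacentTo (i : V) (Γ : EvenClosedWalk G) : Prop :=
  ∃ j ∈ Γ.walk.support, G.Adj i j

end EvenClosedWalk

end Graph

end ConductorIdeal

end

noncomputable section

namespace ConductorIdeal

open MvPolynomial

variable {K : Type*} [Field K] {V : Type*} {G : SimpleGraph V}

/-! The Rees ideal `J` of an edge ideal is generated by `L` and the binomials `h_Γ` of even closed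
walks (`reesIdeal_le`), so `r` lies in the conductor exactly when `r h_Γ ∈ L` for every `Γ`. If `i`
is adjacent to `Γ`, then `x_i h_Γ ∈ L`, by a telescoping chain of exchanges `x_a y_{bc} ≡ x_c
y_{ab}` along the walk (`X_mul_binomial_mem`). Conversely, if `Γ` is non-trivial and `x_i^k h_Γ ∈
L`, then `k ≠ 0` and `i` is adjacent to `Γ`: otherwise some coefficient of `x_i^k h_Γ` equals `1`
although it vanishes on all of `L` (`isAdjacentTo_of_X_pow_mul_binomial_mem`).

Hence `x_i` lies in the conductor, or equivalently in its radical, exactly when `i` is adjacent to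
every non-trivial walk, and the conductor is the unit ideal exactly when no non-trivial walk exists.
Maximality of `𝔪` gives the rest. -/

/-! ### Monomials, edge generators and binomial linear relations -/

/-- The monomial `x^a` whose exponent vector is the multiset `a`. -/
def vertexMonomial (K : Type*) [Field K] (a : Multiset V) : MvPolynomial V K :=
  (a.map X).prod

/-- The monomial `y^α` whose exponent vector is the multiset `α`. -/
def edgeMonomial (K : Type*) [Field K] (α : Multiset G.edgeSet) :
    MvPolynomial G.edgeSet (MvPolynomial V K) :=
  (α.map X).prod

/-- The multiset of endpoints of an edge. -/
def ends (e : G.edgeSet) : Multiset V := e.1.toMultiset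

/-- The generator of the edge ideal given by an edge. -/
def edgeGenerator (K : Type*) [Field K] (G : SimpleGraph V) (e : G.edgeSet) : MvPolynomial V K :=
  vertexMonomial K (ends e)

theorem vertexMonomial_add (a b : Multiset V) :
    vertexMonomial K (a + b) = vertexMonomial K a * vertexMonomial K b := by
  simp [vertexMonomial]

theorem vertexMonomial_singleton (v : V) : vertexMonomial K {v} = X v := by
  simp [vertexMonomial]

theorem edgeMonomial_cons (e : G.edgeSet) (α : Multiset G.edgeSet) :
    edgeMonomial K (e ::ₘ α) = X e * edgeMonomial K α := by
  simp [edgeMonomial]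

theorem ends_mk {a b : V} (h : G.Adj a b) :
    ends (⟨s(a, b), h⟩ : G.edgeSet) = {a} + {b} := rfl

theorem exists_adj_of_mem_ends {v : V} {e : G.edgeSet} (h : v ∈ ends e) :
    ∃ (w : V) (hw : G.Adj v w), e = ⟨s(v, w), hw⟩ := by
  obtain ⟨e, he⟩ := e
  obtain ⟨w, rfl⟩ := Sym2.mem_iff_exists.1 (Sym2.mem_toMultiset.1 h)
  exact ⟨w, he, rfl⟩

theorem mem_ends_mk {a b : V} (h : G.Adj a b) {v : V} :
    v ∈ ends (⟨s(a, b), h⟩ : G.edgeSet) ↔ v = a ∨ v = b := by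
  simp [ends_mk]

theorem span_range_edgeGenerator :
    Ideal.span (Set.range (edgeGenerator K G)) = edgeIdeal K G := by
  refine congrArg Ideal.span (Set.ext fun p => ⟨?_, ?_⟩)
  · rintro ⟨⟨e, he⟩, rfl⟩
    induction e using Sym2.ind with
    | h i j =>
      refine ⟨i, j, he, ?_⟩
      rw [edgeGenerator, ends_mk he, vertexMonomial_add, vertexMonomial_singleton,
        vertexMonomial_singleton]
  · rintro ⟨i, j, h, rfl⟩
    refine ⟨⟨s(i, j), h⟩, ?_⟩
    rw [edgeGenerator, ends_mk h, vertexMonomial_add, vertexMonomial_singleton,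
      vertexMonomial_singleton]

theorem conductor_edgeIdeal :
    conductor (edgeIdeal K G) = conductorOfGenerators (edgeGenerator K G) := by
  rw [← span_range_edgeGenerator, conductorOfGenerators_eq_conductor]

theorem linearIdeal_le_reesIdeal {R ι : Type*} [CommRing R] (f : ι → R) :
    linearIdeal f ≤ reesIdeal f := by
  refine Ideal.span_le.2 ?_
  rintro _ ⟨a, ha, rfl⟩
  change reesMap f (linearForm a) = 0
  rw [reesMap_linearForm, ha]
  simp

theorem C_mul_X_sub_C_mul_X_mem_linearIdeal {R ι : Type*} [CommRing R] {f : ι → R} {r s : R}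
    {i j : ι} (h : r * f i = s * f j) :
    (C r * X i - C s * X j : MvPolynomial ι R) ∈ linearIdeal f := by
  have h1 : linearForm (Finsupp.single i r - Finsupp.single j s) = C r * X i - C s * X j := by
    rw [linearForm_eq, map_sub]
    simp [smul_eq_C_mul]
  rw [← h1]
  refine linearForm_mem ?_
  rw [h1]
  simp only [reesMap, map_sub, map_mul, aeval_X, algHom_C, Polynomial.algebraMap_eq]
  rw [← mul_assoc, ← mul_assoc, ← map_mul, ← map_mul, h, sub_self]

theorem exchange_mem_linearIdeal {a b : Multiset V} {e f : G.edgeSet}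
    (h : a + ends e = b + ends f) :
    (C (vertexMonomial K a) * X e - C (vertexMonomial K b) * X f :
      MvPolynomial G.edgeSet (MvPolynomial V K)) ∈ linearIdeal (edgeGenerator K G) := by
  refine C_mul_X_sub_C_mul_X_mem_linearIdeal ?_
  rw [edgeGenerator, edgeGenerator, ← vertexMonomial_add, ← vertexMonomial_add, h]

/-! ### Alternating products along walks, and `x_i h_Γ ∈ L` -/

open Classical in
/-- The variable of the edge `{a, b}`, and `0` if `a` and `b` are not adjacent. -/
def pairVar (K : Type*) [Field K] (G : SimpleGraph V) (a b : V) :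
    MvPolynomial G.edgeSet (MvPolynomial V K) :=
  if h : G.Adj a b then X ⟨s(a, b), h⟩ else 0

theorem pairVar_of_adj {a b : V} (h : G.Adj a b) : pairVar K G a b = X ⟨s(a, b), h⟩ :=
  dif_pos h

theorem pairVar_exchange {a b c : V} (h : G.Adj a b) (h' : G.Adj b c) :
    C (X a) * pairVar K G b c - C (X c) * pairVar K G a b ∈
      linearIdeal (edgeGenerator K G) := by
  rw [pairVar_of_adj h, pairVar_of_adj h', ← vertexMonomial_singleton, ← vertexMonomial_singleton]
  refine exchange_mem_linearIdeal ?_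
  rw [ends_mk, ends_mk]
  abel

/-- The products of the variables of the edges of a walk in odd and in even position. -/
def alternatingProd (K : Type*) [Field K] : {s u : V} → G.Walk s u →
    MvPolynomial G.edgeSet (MvPolynomial V K) × MvPolynomial G.edgeSet (MvPolynomial V K)
  | _, _, .nil => (1, 1)
  | _, _, .cons (u := s) (v := w) _ p =>
    -- Prepending an edge shifts every position by one, so the two products trade places.
    (pairVar K G s w * (alternatingProd K p).2, (alternatingProd K p).1)

theorem alternatingProd_eq : ∀ (q : ℕ) {s u : V} (p : G.Walk s u), p.length = 2 * q →
    alternatingProd K p =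
      (∏ k ∈ Finset.range q, pairVar K G (p.getVert (2 * k)) (p.getVert (2 * k + 1)),
        ∏ k ∈ Finset.range q, pairVar K G (p.getVert (2 * k + 1)) (p.getVert (2 * k + 1 + 1)))
  | 0, _, _, .nil, _ => by simp [alternatingProd]
  | q + 1, _, _, .cons _ .nil, h => by simp at h; omega
  | q + 1, _, _, .cons _ (.cons _ p), h => by
    simp only [SimpleGraph.Walk.length_cons] at h
    rw [alternatingProd, alternatingProd, alternatingProd_eq q p (by omega),
      Finset.prod_range_succ', Finset.prod_range_succ']
    simp only [mul_add, mul_one, mul_zero, SimpleGraph.Walk.getVert_cons_succ,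
      SimpleGraph.Walk.getVert_zero, zero_add]
    rw [mul_comm, mul_comm (pairVar K G _ _)]

theorem binomial_eq (Γ : EvenClosedWalk G) :
    Γ.binomial (MvPolynomial V K) =
      (alternatingProd K Γ.walk).1 - (alternatingProd K Γ.walk).2 := by
  rw [alternatingProd_eq (Γ.walk.length / 2) Γ.walk (Nat.two_mul_div_two_of_even Γ.even_length).symm,
    EvenClosedWalk.binomial, Finset.prod_range, Finset.prod_range]
  congr 1 <;> refine Finset.prod_congr rfl fun k _ => ?_
  · exact (pairVar_of_adj (Γ.walk.adj_getVert_succ (by omega))).symm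
  · exact (pairVar_of_adj (Γ.walk.adj_getVert_succ (by omega))).symm

theorem alternatingProd_append : ∀ {s t u : V} (p : G.Walk s t) (q : G.Walk t u),
    alternatingProd K (p.append q) = if Even p.length then
      ((alternatingProd K p).1 * (alternatingProd K q).1,
        (alternatingProd K p).2 * (alternatingProd K q).2) else
      ((alternatingProd K p).1 * (alternatingProd K q).2,
        (alternatingProd K p).2 * (alternatingProd K q).1)
  | _, _, _, .nil, q => by simp [alternatingProd]
  | _, _, _, .cons h p, q => by
    rw [SimpleGraph.Walk.cons_append, alternatingProd, alternatingProd, alternatingProd_append p q,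
      SimpleGraph.Walk.length_cons]
    simp only [Nat.even_add_one]
    by_cases hp : Even p.length <;> simp [hp, mul_assoc]

/-- Telescoping: for a walk starting `s, t, r`, the inductive relation turns `x_i` into `x_r
y_{iu}`, and the exchange `x_r y_{st} ≡ x_s y_{tr}` moves the coefficient back to the start. -/
theorem X_mul_alternatingProd_of_odd {i u : V} (hi : G.Adj i u) :
    ∀ {s : V} (p : G.Walk s u), Odd p.length →
      C (X i) * (alternatingProd K p).1 - C (X s) * pairVar K G i u * (alternatingProd K p).2 ∈
        linearIdeal (edgeGenerator K G)
  | _, .nil, h => by simp at h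
  | s, .cons h .nil, _ => by
    have := pairVar_exchange (K := K) hi h.symm
    have e : pairVar K G s u = pairVar K G u s := by
      rw [pairVar_of_adj h, pairVar_of_adj h.symm]
      congr 2
      exact Sym2.eq_swap
    simpa [alternatingProd, e] using this
  | s, .cons (v := t) h (.cons (v := r) h' p), hp => by
    have h1 := X_mul_alternatingProd_of_odd hi p (by
      simp only [SimpleGraph.Walk.length_cons] at hp
      grind)
    have h2 := pairVar_exchange (K := K) h h'
    simp only [alternatingProd]
    have h3 := sub_mem (Ideal.mul_mem_left _ (pairVar K G s t) h1)
      (Ideal.mul_mem_left _ (pairVar K G i u * (alternatingProd K p).2) h2)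
    convert h3 using 1
    ring

/-- Removing the first edge `{s, w}` leaves an odd walk from `w` to `s`; its telescoped relation is
closed up by `x_w y_{is} ≡ x_i y_{sw}`. -/
theorem X_mul_sub_mem_of_adj_base {i s : V} (hi : G.Adj i s) (p : G.Walk s s)
    (hp : Even p.length) :
    C (X i) * ((alternatingProd K p).1 - (alternatingProd K p).2) ∈
      linearIdeal (edgeGenerator K G) := by
  cases p with
  | nil => simp [alternatingProd]
  | cons h p =>
    rename_i w
    have h1 := X_mul_alternatingProd_of_odd (K := K) hi p (by
      simp only [SimpleGraph.Walk.length_cons] at hp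
      grind)
    have h2 := pairVar_exchange (K := K) hi h
    simp only [alternatingProd]
    have h3 := sub_mem (Ideal.mul_mem_left _ (alternatingProd K p).2 h2) h1
    convert h3 using 1
    ring

theorem X_mul_binomial_mem {i : V} {Γ : EvenClosedWalk G} (h : Γ.IsAdjacentTo i) :
    C (X i) * Γ.binomial (MvPolynomial V K) ∈ linearIdeal (edgeGenerator K G) := by
  classical
  obtain ⟨j, hj, hij⟩ := h
  rw [binomial_eq]
  have hΓ := Γ.even_length
  rw [← Γ.walk.take_spec hj] at hΓ ⊢
  generalize Γ.walk.takeUntil j hj = p at *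
  generalize Γ.walk.dropUntil j hj = q at *
  -- Rotate the walk so that it starts at `j`. Rotating by an odd number of edges only changes the
  -- sign of the binomial.
  have h1 := X_mul_sub_mem_of_adj_base (K := K) hij (q.append p) (by
    rw [SimpleGraph.Walk.length_append] at hΓ ⊢
    rwa [add_comm])
  rw [alternatingProd_append] at h1 ⊢
  rw [SimpleGraph.Walk.length_append, Nat.even_add] at hΓ
  by_cases hp : Even p.length
  · rw [if_pos (hΓ.1 hp)] at h1
    rw [if_pos hp]
    convert h1 using 1
    ring
  · rw [if_neg (fun h => hp (hΓ.2 h))] at h1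
    rw [if_neg hp]
    convert neg_mem h1 using 1
    ring

/-- No telescoping in `R[t]` is needed: some `x_i h_Γ` lies in `L ⊆ J`, and `J` is a prime
containing no `x_i`. -/
theorem binomial_mem_reesIdeal (Γ : EvenClosedWalk G) :
    Γ.binomial (MvPolynomial V K) ∈ reesIdeal (edgeGenerator K G) := by
  have hadj := Γ.walk.adj_getVert_succ Γ.length_pos
  rw [SimpleGraph.Walk.getVert_zero] at hadj
  have h1 := linearIdeal_le_reesIdeal _ (X_mul_binomial_mem (K := K) (Γ := Γ)
    ⟨Γ.base, Γ.walk.start_mem_support, hadj.symm⟩)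
  have : (reesIdeal (edgeGenerator K G)).IsPrime := RingHom.ker_isPrime _
  refine (this.mem_or_mem h1).resolve_left fun h2 => ?_
  change reesMap _ _ = 0 at h2
  rw [reesMap, algHom_C, Polynomial.algebraMap_eq, Polynomial.C_eq_zero] at h2
  exact X_ne_zero _ h2

/-! ### Generation of the Rees ideal by `L` and the walk binomials -/

section Generation

variable {N : Ideal (MvPolynomial G.edgeSet (MvPolynomial V K))}

theorem closed_walk_mem (hN : ∀ Γ : EvenClosedWalk G, Γ.binomial (MvPolynomial V K) ∈ N) {s : V}
    (p : G.Walk s s) (hp : Even p.length) :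
    (alternatingProd K p).1 - (alternatingProd K p).2 ∈ N := by
  cases p with
  | nil => simp [alternatingProd]
  | cons h p =>
    have := hN ⟨s, .cons h p, by simp, hp⟩
    rwa [binomial_eq] at this

/-- Binomials extending an alternating walk from `s` to `u` by edges `α` and `β` that balance its
ends. -/
theorem alternating_binomial_mem
    (hN : ∀ Γ : EvenClosedWalk G, Γ.binomial (MvPolynomial V K) ∈ N) :
    ∀ (d : ℕ) {s u : V} (p : G.Walk s u), Even p.length → ∀ α β : Multiset G.edgeSet,
      α.card = d → β.card = d → {s} + α.bind ends = {u} + β.bind ends →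
      (alternatingProd K p).1 * edgeMonomial K α - (alternatingProd K p).2 * edgeMonomial K β ∈ N
  | 0, s, u, p, hp, α, β, hα, hβ, h => by
    rw [Multiset.card_eq_zero] at hα hβ
    subst hα hβ
    obtain rfl : s = u := by simpa using h
    simpa [edgeMonomial] using closed_walk_mem hN p hp
  | d + 1, s, u, p, hp, α, β, hα, hβ, h => by
    -- If `{s, w}` is an edge of `β`, the balance forces an edge `{w, z}` of `α`. Moving both edges
    -- into the walk, as `z, w, s, …`, lowers `d` and keeps the balance.
    have step : ∀ {s u : V} (p : G.Walk s u), Even p.length →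
        {s} + α.bind ends = {u} + β.bind ends → s ∈ β.bind ends →
        (alternatingProd K p).1 * edgeMonomial K α -
          (alternatingProd K p).2 * edgeMonomial K β ∈ N := by
      intro s u p hp h hs
      obtain ⟨e, he, hse⟩ := Multiset.mem_bind.1 hs
      obtain ⟨w, hsw, rfl⟩ := exists_adj_of_mem_ends hse
      obtain ⟨β', rfl⟩ := Multiset.exists_cons_of_mem he
      rw [Multiset.cons_bind, ends_mk] at h
      have h1 : α.bind ends = {u} + {w} + β'.bind ends := by
        refine add_left_cancel (a := ({s} : Multiset V)) (h.trans ?_)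
        abel
      have hw : w ∈ α.bind ends := by simp [h1]
      obtain ⟨e', he', hwe⟩ := Multiset.mem_bind.1 hw
      obtain ⟨z, hwz, rfl⟩ := exists_adj_of_mem_ends hwe
      obtain ⟨α', rfl⟩ := Multiset.exists_cons_of_mem he'
      rw [Multiset.cons_bind, ends_mk] at h1
      have h2 : {z} + α'.bind ends = {u} + β'.bind ends := by
        refine add_left_cancel (a := ({w} : Multiset V)) ?_
        rw [← add_assoc, h1]
        abel
      have h3 := alternating_binomial_mem hN d (.cons hwz.symm (.cons hsw.symm p))
        (by simpa [Nat.even_add_one] using hp) α' β' (by simpa using hα) (by simpa using hβ) h2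
      simp only [alternatingProd, pairVar_of_adj hwz.symm, pairVar_of_adj hsw.symm] at h3
      rw [edgeMonomial_cons, edgeMonomial_cons]
      simp only [Sym2.eq_swap (a := z), Sym2.eq_swap (a := w) (b := s)] at h3
      convert h3 using 1
      ring
    by_cases hsu : s = u
    · subst hsu
      -- The walk has closed up, so its own binomial splits off; restart with the empty walk at an
      -- endpoint of an edge of `β`.
      obtain ⟨e, he⟩ := Multiset.card_pos_iff_exists_mem.1 (by omega : 0 < β.card)
      obtain ⟨⟨v, w⟩, hvw⟩ := e
      have h1 := step (.nil : G.Walk v v) (by simp)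
        (by rw [add_left_cancel h]) (Multiset.mem_bind.2 ⟨_, he, (mem_ends_mk hvw).2 (.inl rfl)⟩)
      simp only [alternatingProd, one_mul] at h1
      have h2 := add_mem (Ideal.mul_mem_right (edgeMonomial K α) _ (closed_walk_mem hN p hp))
        (Ideal.mul_mem_left _ (alternatingProd K p).2 h1)
      convert h2 using 1
      ring
    · refine step p hp h ?_
      have : s ∈ {u} + β.bind ends := by simp [← h]
      simpa [hsu] using this

/-- When `a = b`, the edges of `α` and `β` can be arranged into closed walks. Otherwise some vertex
`v` has excess in `a`, hence lies on an edge `{v, w}` of `β`; modulo `L` that edge can be moved into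
the first monomial and cancelled, lowering the degree. -/
theorem binomial_mem (hL : linearIdeal (edgeGenerator K G) ≤ N)
    (hN : ∀ Γ : EvenClosedWalk G, Γ.binomial (MvPolynomial V K) ∈ N) :
    ∀ (d : ℕ) (a b : Multiset V) (α β : Multiset G.edgeSet), α.card = d → β.card = d →
      a + α.bind ends = b + β.bind ends →
      C (vertexMonomial K a) * edgeMonomial K α - C (vertexMonomial K b) * edgeMonomial K β ∈ N
  | 0, a, b, α, β, hα, hβ, h => by
    rw [Multiset.card_eq_zero] at hα hβ
    subst hα hβ
    obtain rfl : a = b := by simpa using h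
    simp
  | d + 1, a, b, α, β, hα, hβ, h => by
    classical
    by_cases hab : a = b
    · subst hab
      obtain ⟨⟨⟨v, w⟩, hvw⟩, he⟩ := Multiset.card_pos_iff_exists_mem.1 (by omega : 0 < β.card)
      have h1 := alternating_binomial_mem hN (d + 1) (.nil : G.Walk v v) (by simp) α β hα hβ
        (by rw [add_left_cancel h])
      simp only [alternatingProd, one_mul] at h1
      rw [← mul_sub]
      exact Ideal.mul_mem_left _ _ h1
    have hbind : ∀ γ : Multiset G.edgeSet, (γ.bind ends).card = γ.card * 2 := fun γ => by
      rw [Multiset.card_bind, Multiset.map_congr rfl (g := fun _ => 2)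
        (fun e _ => Sym2.card_toMultiset e.1)]
      simp
    have hcard : a.card = b.card := by
      have := congrArg Multiset.card h
      rw [Multiset.card_add, Multiset.card_add, hbind, hbind] at this
      omega
    obtain ⟨v, hv⟩ : ∃ v, b.count v < a.count v := by
      by_contra! hle
      exact hab (Multiset.eq_of_le_of_card_le (Multiset.le_iff_count.2 hle) hcard.ge)
    have hvβ : v ∈ β.bind ends := by
      have := congrArg (Multiset.count v) h
      rw [Multiset.count_add, Multiset.count_add] at this
      exact Multiset.count_pos.1 (by omega)
    obtain ⟨e, he, hve⟩ := Multiset.mem_bind.1 hvβ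
    obtain ⟨w, hvw, rfl⟩ := exists_adj_of_mem_ends hve
    obtain ⟨β', rfl⟩ := Multiset.exists_cons_of_mem he
    obtain ⟨a', rfl⟩ := Multiset.exists_cons_of_mem (Multiset.count_pos.1 (hv.trans_le' (by simp)))
    -- one exchange brings the edge `{v, w}` into the first monomial
    suffices ∃ (g : G.edgeSet) (α' : Multiset G.edgeSet) (c c' k : Multiset V), α = g ::ₘ α' ∧
        v ::ₘ a' = k + c ∧ c + ends g = c' + ends ⟨s(v, w), hvw⟩ by
      obtain ⟨g, α', c, c', k, rfl, hk, hc⟩ := this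
      rw [hk, Multiset.cons_bind, Multiset.cons_bind] at h
      have h1 : k + c' + α'.bind ends = b + β'.bind ends := by
        refine add_left_cancel (a := ends ⟨s(v, w), hvw⟩) ?_
        calc _ = k + (c' + ends ⟨s(v, w), hvw⟩) + α'.bind ends := by abel
          _ = k + c + (ends g + α'.bind ends) := by rw [← hc]; abel
          _ = _ := by rw [h]; abel
      have h2 := binomial_mem hL hN d (k + c') b α' β' (by simpa using hα) (by simpa using hβ) h1
      have h3 := hL (exchange_mem_linearIdeal (K := K) hc)
      rw [hk, edgeMonomial_cons, edgeMonomial_cons]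
      have h4 := add_mem
        (Ideal.mul_mem_left _ (C (vertexMonomial K k) * edgeMonomial K α') h3)
        (Ideal.mul_mem_left _ (X ⟨s(v, w), hvw⟩) h2)
      rw [vertexMonomial_add, map_mul] at h4 ⊢
      convert h4 using 1
      ring
    by_cases hw : w ∈ a'
    -- Here `x_v x_w y_g ≡ x^{ends g} y_{vw}` for an arbitrary edge `g` of `α`.
    · obtain ⟨a'', rfl⟩ := Multiset.exists_cons_of_mem hw
      obtain ⟨g, hg⟩ := Multiset.card_pos_iff_exists_mem.1 (by omega : 0 < α.card)
      obtain ⟨α', rfl⟩ := Multiset.exists_cons_of_mem hg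
      refine ⟨g, α', {v} + {w}, ends g, a'', rfl, ?_, ?_⟩
      · simp only [← Multiset.singleton_add]
        abel
      · rw [ends_mk, add_comm]
    -- Here `w` lies on an edge `{w, u}` of `α`, and `x_v y_{wu} ≡ x_u y_{vw}`.
    · have hwα : w ∈ α.bind ends := by
        have h1 : w ∈ v ::ₘ a' + α.bind ends := by
          rw [h]
          simp [Multiset.mem_bind, ends_mk]
        simpa [hvw.ne', hw] using h1
      obtain ⟨g, hg, hwg⟩ := Multiset.mem_bind.1 hwα
      obtain ⟨u, hwu, rfl⟩ := exists_adj_of_mem_ends hwg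
      obtain ⟨α', rfl⟩ := Multiset.exists_cons_of_mem hg
      refine ⟨_, α', {v}, {u}, a', rfl, ?_, ?_⟩
      · rw [← Multiset.singleton_add, add_comm]
      · rw [ends_mk, ends_mk]
        abel

theorem reesMap_monomial (a : Multiset V) (α : Multiset G.edgeSet) :
    reesMap (edgeGenerator K G) (C (vertexMonomial K a) * edgeMonomial K α) =
      Polynomial.C (vertexMonomial K (a + α.bind ends)) * Polynomial.X ^ α.card := by
  induction α using Multiset.induction with
  | empty => simp [reesMap, edgeMonomial]
  | cons e α ih =>
    rw [edgeMonomial_cons, mul_left_comm, map_mul, ih, Multiset.cons_bind, add_left_comm,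
      vertexMonomial_add (ends e), Multiset.card_cons, map_mul, reesMap, aeval_X, edgeGenerator]
    ring

theorem monomial_toFinsupp_eq {σ R : Type*} [DecidableEq σ] [CommSemiring R] (a : Multiset σ) :
    monomial (Multiset.toFinsupp a) (1 : R) = (a.map X).prod := by
  induction a using Multiset.induction with
  | empty => simp
  | cons v a ih =>
    rw [Multiset.map_cons, Multiset.prod_cons, ← ih, ← Multiset.singleton_add, map_add,
      Multiset.toFinsupp_singleton, X, monomial_mul, one_mul]

theorem monomial_one_eq {σ R : Type*} [CommSemiring R] (s : σ →₀ ℕ) :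
    monomial s (1 : R) = ((Finsupp.toMultiset s).map X).prod := by
  classical
  rw [← monomial_toFinsupp_eq, Finsupp.toMultiset_toFinsupp]

/-- The map `φ` sends monomials to monomials, and by `binomial_mem` two monomials with the same
image agree modulo `N`. Choosing preimages of monomials therefore gives a `K`-linear `Ψ` such that
`Ψ ∘ φ` is the quotient map by `N`, so `Ker φ ⊆ N`. -/
theorem reesIdeal_le (hL : linearIdeal (edgeGenerator K G) ≤ N)
    (hN : ∀ Γ : EvenClosedWalk G, Γ.binomial (MvPolynomial V K) ∈ N) :
    reesIdeal (edgeGenerator K G) ≤ N := by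
  classical
  let B := (basisMonomials V K).smulTower (Polynomial.basisMonomials (MvPolynomial V K))
  let P : (V →₀ ℕ) × ℕ → Multiset V × Multiset G.edgeSet → Prop := fun k c =>
    c.1 + c.2.bind ends = Finsupp.toMultiset k.1 ∧ c.2.card = k.2
  let rep : (V →₀ ℕ) × ℕ → MvPolynomial G.edgeSet (MvPolynomial V K) ⧸ N := fun k =>
    if h : ∃ c, P k c then
      -- The value `0` is only taken at monomials outside the image of `φ`, where it plays no role.
      Ideal.Quotient.mk N (C (vertexMonomial K h.choose.1) * edgeMonomial K h.choose.2) else 0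
  let Ψ : Polynomial (MvPolynomial V K) →ₗ[K] MvPolynomial G.edgeSet (MvPolynomial V K) ⧸ N :=
    B.constr K rep
  have hΨ : ∀ (a : Multiset V) (α : Multiset G.edgeSet),
      Ψ (reesMap (edgeGenerator K G) (C (vertexMonomial K a) * edgeMonomial K α)) =
        Ideal.Quotient.mk N (C (vertexMonomial K a) * edgeMonomial K α) := fun a α => by
    let k : (V →₀ ℕ) × ℕ := (Multiset.toFinsupp (a + α.bind ends), α.card)
    have hk : ∃ c, P k c := ⟨(a, α), by simp [P, k]⟩
    have hB : B k = Polynomial.C (vertexMonomial K (a + α.bind ends)) * Polynomial.X ^ α.card := by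
      rw [Module.Basis.smulTower_apply, coe_basisMonomials, Polynomial.coe_basisMonomials,
        vertexMonomial, ← monomial_toFinsupp_eq, Polynomial.C_mul_X_pow_eq_monomial,
        Polynomial.smul_monomial]
      simp [k]
    rw [reesMap_monomial, ← hB, Module.Basis.constr_basis]
    simp only [rep, dif_pos hk]
    refine Ideal.Quotient.eq.2 (binomial_mem hL hN α.card _ _ _ _ hk.choose_spec.2 rfl ?_)
    rw [hk.choose_spec.1]
    simp [k]
  have hall : ∀ p, Ψ (reesMap (edgeGenerator K G) p) = Ideal.Quotient.mk N p := by
    intro p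
    induction p using MvPolynomial.induction_on' with
    | add p q hp hq => rw [map_add, map_add, hp, hq, map_add]
    | monomial s r =>
      induction r using MvPolynomial.induction_on' with
      | add p q hp hq => rw [map_add, map_add, map_add, hp, hq, map_add]
      | monomial t c =>
        have h1 : monomial s (monomial t c) = c • (C (vertexMonomial K (Finsupp.toMultiset t)) *
            edgeMonomial K (Finsupp.toMultiset s)) := by
          rw [vertexMonomial, edgeMonomial, ← monomial_one_eq, ← monomial_one_eq, C_mul_monomial,
            mul_one, smul_monomial, smul_monomial, smul_eq_mul, mul_one]
        have h2 := hΨ (Finsupp.toMultiset t) (Finsupp.toMultiset s)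
        rw [h1, ← IsScalarTower.algebraMap_smul (MvPolynomial V K) c, map_smul,
          IsScalarTower.algebraMap_smul, map_smul, h2,
          IsScalarTower.algebraMap_smul, ← Ideal.Quotient.mkₐ_eq_mk K, ← map_smul]
  intro p hp
  refine Ideal.Quotient.eq_zero_iff_mem.1 ?_
  rw [← hall, show reesMap (edgeGenerator K G) p = 0 from hp, map_zero]

end Generation

/-! ### Coefficient obstruction to membership in `L` -/

/-- If no `m l` other than `m j` is at most `s + m j`, for the indices `j` of `t`, then the
coefficient of `x^s y^t` vanishes on `L`. -/
theorem coeff_coeff_eq_zero_of_mem_linearIdeal {R ι σ : Type*} [CommRing R] {m : ι → σ →₀ ℕ}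
    {s : σ →₀ ℕ} {t : ι →₀ ℕ} (h : ∀ j ∈ t.support, ∀ l, m l ≤ s + m j → l = j)
    {p : MvPolynomial ι (MvPolynomial σ R)} (hp : p ∈ linearIdeal fun j => monomial (m j) (1 : R)) :
    (p.coeff t).coeff s = 0 := by
  classical
  rw [linearIdeal, Ideal.span] at hp
  induction hp using Submodule.span_induction generalizing s t with
  | zero => simp
  | add p q _ _ hp hq => rw [coeff_add, coeff_add, hp h, hq h, add_zero]
  | mem p hp =>
    obtain ⟨a, ha, rfl⟩ := hp
    rw [linearForm, Finsupp.sum, coeff_sum, coeff_sum]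
    refine Finset.sum_eq_zero fun j _ => ?_
    rw [coeff_C_mul, coeff_X]
    split_ifs with hj
    · rw [mul_one]
      have hjt : j ∈ t.support := by simp [← hj]
      -- In degree `s + m j` of `∑ a_l x^{m l} = 0`, the hypothesis leaves only the term `l = j`.
      have h1 := congrArg (coeff (s + m j)) ha
      rw [Finsupp.sum, coeff_sum, coeff_zero, Finset.sum_eq_single j] at h1
      · rwa [coeff_mul_monomial, mul_one] at h1
      · intro l _ hl
        rw [coeff_mul_monomial', if_neg fun hle => hl (h j hjt l hle)]
      · intro hj
        rw [Finsupp.notMem_support_iff.1 hj, zero_mul, coeff_zero]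
    · simp
  | smul q p _ hp =>
    rw [smul_eq_mul, coeff_mul, coeff_sum]
    refine Finset.sum_eq_zero fun u hu => ?_
    rw [coeff_mul]
    refine Finset.sum_eq_zero fun v hv => ?_
    rw [hp, mul_zero]
    -- The hypothesis passes to smaller `s` and `t`, hence to the factors of a product.
    intro j hj l hl
    have hut : u.2 ≤ t := le_add_self.trans (Finset.HasAntidiagonal.mem_antidiagonal.1 hu).le
    have hvs : v.2 ≤ s := le_add_self.trans (Finset.HasAntidiagonal.mem_antidiagonal.1 hv).le
    exact h j (Finsupp.support_mono hut hj) l (hl.trans (by gcongr))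

theorem edgeGenerator_eq_monomial [DecidableEq V] :
    edgeGenerator K G = fun e => monomial (Multiset.toFinsupp (ends e)) (1 : K) :=
  funext fun e => (monomial_toFinsupp_eq (ends e)).symm

/-- The binomial of a non-trivial even closed walk has a monomial with coefficient `1` whose edges
have their endpoints on the walk. -/
theorem exists_coeff_binomial {Γ : EvenClosedWalk G} (h : Γ.IsNontrivial (MvPolynomial V K)) :
    ∃ t : G.edgeSet →₀ ℕ, (Γ.binomial (MvPolynomial V K)).coeff t = 1 ∧
      ∀ e ∈ t.support, ∀ v ∈ ends e, v ∈ Γ.walk.support := by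
  classical
  have hprod : ∀ g : Fin (Γ.walk.length / 2) → G.edgeSet,
      (∏ k, X (g k) : MvPolynomial G.edgeSet (MvPolynomial V K)) =
        monomial (∑ k, Finsupp.single (g k) 1) 1 := fun g => by
    rw [monomial_sum_one]
    rfl
  rw [EvenClosedWalk.IsNontrivial, EvenClosedWalk.binomial, hprod, hprod] at h
  rw [EvenClosedWalk.binomial, hprod, hprod]
  refine ⟨∑ k : Fin (Γ.walk.length / 2), Finsupp.single (Γ.edge (2 * k) (by omega)) 1, ?_, ?_⟩
  · rw [coeff_sub, coeff_monomial, coeff_monomial, if_pos rfl, if_neg, sub_zero]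
    intro heq
    exact h (by rw [heq, sub_self])
  · intro e he v hv
    obtain ⟨k, -, hk⟩ := Finset.mem_biUnion.1 (Finsupp.support_finsetSum he)
    obtain rfl : e = _ := Finset.mem_singleton.1 (Finsupp.support_single_subset hk)
    rcases (mem_ends_mk (Γ.walk.adj_getVert_succ (by omega))).1 hv with rfl | rfl <;>
      exact Γ.walk.getVert_mem_support _

/-- Let `j` be an edge occurring in the chosen monomial of `h_Γ`. A different edge dividing `x_i^k
x^{ends j}` must join `i` to an end of `j`, with `k ≠ 0`; that end lies on `Γ`. Failing this, the
coefficient `1` at `x_i^k y^t` contradicts membership in `L`. Allowing `k = 0` also settles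
properness of the conductor. -/
theorem isAdjacentTo_of_X_pow_mul_binomial_mem {Γ : EvenClosedWalk G}
    (h : Γ.IsNontrivial (MvPolynomial V K)) {i : V} {k : ℕ}
    (hk : C (X i ^ k) * Γ.binomial (MvPolynomial V K) ∈ linearIdeal (edgeGenerator K G)) :
    k ≠ 0 ∧ Γ.IsAdjacentTo i := by
  classical
  by_contra hcon
  obtain ⟨t, ht, hsupp⟩ := exists_coeff_binomial h
  rw [edgeGenerator_eq_monomial] at hk
  have h1 := coeff_coeff_eq_zero_of_mem_linearIdeal (s := Finsupp.single i k) (t := t) ?_ hk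
  · rw [coeff_C_mul, ht, mul_one, coeff_X_pow, if_pos rfl] at h1
    exact one_ne_zero h1
  rintro j hj ⟨⟨p, q⟩, hpq : G.Adj p q⟩ hle
  have hmem : ∀ v w, G.Adj v w → v ∈ ends ⟨s(p, q), hpq⟩ → w ∈ ends ⟨s(p, q), hpq⟩ →
      v ∈ ends j := by
    intro v w hvw hv hw
    by_contra hvj
    have hle' : ∀ u, u ∈ ends ⟨s(p, q), hpq⟩ → u ∉ ends j → u = i ∧ k ≠ 0 := by
      intro u hu huj
      have h2 := hle u
      rw [Finsupp.add_apply, Multiset.toFinsupp_apply, Multiset.toFinsupp_apply,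
        Multiset.count_eq_zero_of_notMem huj, add_zero, Finsupp.single_apply] at h2
      have h3 : 0 < Multiset.count u (ends ⟨s(p, q), hpq⟩) := Multiset.count_pos.2 hu
      have h4 := h3.trans_le h2
      split_ifs at h4 with h5
      · exact ⟨h5.symm, h4.ne'⟩
      · exact absurd h4 (lt_irrefl 0)
    obtain ⟨rfl, hk0⟩ := hle' v hv hvj
    -- Only `i` can lie outside `j`, and the edge is not a loop.
    have hwj : w ∈ ends j := by
      by_contra hwj
      exact hvw.ne (hle' w hw hwj).1.symm
    exact hcon ⟨hk0, w, hsupp j hj w hwj, hvw⟩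
  have hp := hmem p q hpq ((mem_ends_mk hpq).2 (.inl rfl)) ((mem_ends_mk hpq).2 (.inr rfl))
  have hq := hmem q p hpq.symm ((mem_ends_mk hpq).2 (.inr rfl)) ((mem_ends_mk hpq).2 (.inl rfl))
  exact Subtype.ext ((Sym2.mem_and_mem_iff hpq.ne).1
    ⟨Sym2.mem_toMultiset.1 hp, Sym2.mem_toMultiset.1 hq⟩).symm

/-! ### The conductor and its radical -/

theorem conductor_ne_top {Γ : EvenClosedWalk G} (h : Γ.IsNontrivial (MvPolynomial V K)) :
    conductor (edgeIdeal K G) ≠ ⊤ := by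
  intro htop
  have h1 : (1 : MvPolynomial V K) ∈ conductor (edgeIdeal K G) := by simp [htop]
  rw [conductor_edgeIdeal, mem_conductorOfGenerators] at h1
  refine (isAdjacentTo_of_X_pow_mul_binomial_mem h (i := Γ.base) (k := 0) ?_).1 rfl
  simpa using h1 _ (binomial_mem_reesIdeal Γ)

theorem isAdjacentTo_of_mem_radical {Γ : EvenClosedWalk G} (h : Γ.IsNontrivial (MvPolynomial V K))
    {i : V} (hi : X i ∈ (conductor (edgeIdeal K G)).radical) : Γ.IsAdjacentTo i := by
  obtain ⟨k, hk⟩ := hi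
  rw [conductor_edgeIdeal, mem_conductorOfGenerators] at hk
  exact (isAdjacentTo_of_X_pow_mul_binomial_mem h (hk _ (binomial_mem_reesIdeal Γ))).2

theorem conductor_eq_top (h : ∀ Γ : EvenClosedWalk G, ¬ Γ.IsNontrivial (MvPolynomial V K)) :
    conductor (edgeIdeal K G) = ⊤ := by
  rw [conductor_edgeIdeal, Ideal.eq_top_iff_one, mem_conductorOfGenerators]
  intro p hp
  rw [map_one, one_mul]
  refine reesIdeal_le le_rfl (fun Γ => ?_) hp
  rw [not_not.1 (h Γ)]
  exact zero_mem _

theorem X_mem_conductor {i : V}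
    (h : ∀ Γ : EvenClosedWalk G, Γ.IsNontrivial (MvPolynomial V K) → Γ.IsAdjacentTo i) :
    X i ∈ conductor (edgeIdeal K G) := by
  rw [conductor_edgeIdeal, mem_conductorOfGenerators]
  intro p hp
  -- Taking `N = L : x_i` in `reesIdeal_le` reduces the claim to the generators of `J`.
  have hcolon : ∀ q, q ∈ (linearIdeal (edgeGenerator K G)).colon {C (X i)} ↔
      C (X i) * q ∈ linearIdeal (edgeGenerator K G) := fun q => by
    rw [Submodule.mem_colon_singleton, smul_eq_mul, mul_comm]
  refine (hcolon p).1 (reesIdeal_le (fun q hq => ?_) (fun Γ => ?_) hp)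
  · exact (hcolon q).2 (Ideal.mul_mem_left _ _ hq)
  · rw [hcolon]
    by_cases hΓ : Γ.IsNontrivial (MvPolynomial V K)
    · exact X_mul_binomial_mem (h Γ hΓ)
    · rw [not_not.1 hΓ, mul_zero]
      exact zero_mem _

theorem idealOfVars_isMaximal (V K : Type*) [Field K] : (idealOfVars V K).IsMaximal := by
  have h : idealOfVars V K = RingHom.ker (constantCoeff : MvPolynomial V K →+* K) := by
    ext p
    rw [← pow_one (idealOfVars V K), mem_pow_idealOfVars_iff', RingHom.mem_ker, constantCoeff_eq]
    simp [Finsupp.degree_eq_zero_iff]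
  rw [h]
  exact RingHom.ker_isMaximal_of_surjective _ fun c => ⟨C c, constantCoeff_C V c⟩

end ConductorIdeal

end

theorem mainTheorem7 {K : Type*} [Field K] {V : Type*} [Finite V] (G : SimpleGraph V) :
    List.TFAE
      [ConductorIdeal.IsPrimaryTo
          (ConductorIdeal.conductor (ConductorIdeal.edgeIdeal K G)) (MvPolynomial.idealOfVars V K),
        ConductorIdeal.conductor (ConductorIdeal.edgeIdeal K G) = MvPolynomial.idealOfVars V K,
        (∃ Γ : ConductorIdeal.EvenClosedWalk G, Γ.IsNontrivial (MvPolynomial V K)) ∧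
          ∀ (i : V) (Γ : ConductorIdeal.EvenClosedWalk G),
            Γ.IsNontrivial (MvPolynomial V K) →
              ConductorIdeal.EvenClosedWalk.IsAdjacentTo i Γ] := by
  have hmax := ConductorIdeal.idealOfVars_isMaximal V K
  tfae_have 2 → 1 := fun h => by
    rw [h]
    exact ⟨hmax.isPrime.isPrimary, hmax.isPrime.radical⟩
  tfae_have 1 → 3 := by
    rintro ⟨hprim, hrad⟩
    refine ⟨?_, fun i Γ hΓ => ConductorIdeal.isAdjacentTo_of_mem_radical hΓ ?_⟩
    · by_contra! hnone
      exact hprim.ne_top (ConductorIdeal.conductor_eq_top hnone)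
    · rw [hrad]
      exact Ideal.subset_span ⟨i, rfl⟩
  tfae_have 3 → 2 := by
    rintro ⟨⟨Γ, hΓ⟩, hadj⟩
    -- The conductor is proper and contains every variable, so it equals the maximal ideal `𝔪`.
    refine (hmax.eq_of_le (ConductorIdeal.conductor_ne_top hΓ) (Ideal.span_le.2 ?_)).symm
    rintro _ ⟨i, rfl⟩
    exact ConductorIdeal.X_mem_conductor (hadj i)
  tfae_finish
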